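/- Let $k$ be a field, let $a,b,n,\rho\ge 0$ be integers, and let $A\subseteq \mathrm{M}_{a,b}(k)$ be a $k$-linear subspace of dimension $n+1$ of constant rank $\rho$, that is, every nonzero matrix in $A$ has rank $\rho$. Then for all integers $\alpha\ge\rho+n$ and $\beta\ge\rho+n$ there exist matrices $P\in \mathrm{M}_{\alpha,a}(k)$ and $Q\in \mathrm{M}_{b,\beta}(k)$ of maximal rank, $\operatorname{rank}P=\min(\alpha,a)$ and $\operatorname{rank}Q=\min(b,\beta)$, such that the linear space $$A'=\{\,PMQ : M\in A\,\}\subseteq \mathrm{M}_{\alpha,\beta}(k)$$ has dimension $n+1$ and constant rank $\rho$. In particular, if $\alpha\le a$ and $\beta\le b$, then $P$ and $Q$ define surjective linear maps (projections) $k^a\to k^\alpha$ and $k^b\to k^\beta$, $u\mapsto Pu$ and $w\mapsto Q^{T}w$, and $A'$ is the image of $A$ under the induced projection $k^a\otimes k^b\to k^\alpha\otimes k^\beta$. -/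

import Mathlib

/-- A linear space `A` of `a × b` matrices over `k` has constant rank `ρ` if every nonzero
matrix in `A` has rank `ρ`. -/
def IsConstantRank {k : Type*} [Field k] {a b : ℕ}
    (A : Submodule k (Matrix (Fin a) (Fin b) k)) (ρ : ℕ) : Prop :=
  ∀ M ∈ A, M ≠ 0 → M.rank = ρ

/-- The linear map `M ↦ P * M * Q` from `a × b` matrices to `α × β` matrices. Here `P` acts on
the columns of `M` as a linear map `k ^ a → k ^ α`, and `Q` acts on the rows of `M` as a linear
map `k ^ b → k ^ β`. When `P` and `Q` have rank `α` and `β`, both maps are surjective, and this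
is the map on matrices (that is, on `k ^ a ⊗ k ^ b`) induced by the two projections. -/
def matrixProjection {k : Type*} [Field k] {a b α β : ℕ}
    (P : Matrix (Fin α) (Fin a) k) (Q : Matrix (Fin b) (Fin β) k) :
    Matrix (Fin a) (Fin b) k →ₗ[k] Matrix (Fin α) (Fin β) k where
  toFun M := P * M * Q
  map_add' M N := by rw [Matrix.mul_add, Matrix.add_mul]
  map_smul' c M := by rw [Matrix.mul_smul, Matrix.smul_mul, RingHom.id_apply]

/-! Multiplication by `P` preserves the rank of `M` as soon as `ker P` meets the column space of `M`
trivially. As `M` runs over the nonzero elements of `A`, these column spaces sweep out a set of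
dimension at most `ρ + n`, since scaling `M` changes nothing. So they miss some vector whenever the
ambient dimension exceeds `ρ + n` (`exists_notMem_range`). Quotienting by such a vector keeps all
ranks, and iterating builds the kernel (`exists_finrank_eq_disjoint_range`). Transposing gives `Q`.
-/

open Module in
theorem finrank_range_comp_of_disjoint {k E V W : Type*} [Field k] [AddCommGroup E] [Module k E]
    [AddCommGroup V] [Module k V] [AddCommGroup W] [Module k W]
    (p : V →ₗ[k] W) (f : E →ₗ[k] V) (h : Disjoint (LinearMap.ker p) (LinearMap.range f)) :
    finrank k (LinearMap.range (p ∘ₗ f)) = finrank k (LinearMap.range f) := by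
  rw [LinearMap.range_comp, ← LinearMap.range_domRestrict]
  apply LinearMap.finrank_range_of_inj
  rw [← LinearMap.ker_eq_bot, LinearMap.ker_eq_bot']
  rintro ⟨x, hx⟩ hpx
  exact Subtype.ext (Submodule.disjoint_def.1 h x hpx hx)

/-- Over a finite field, a family of linear maps of rank `ρ` parametrized by the nonzero vectors of
an `(n + 1)`-dimensional space does not cover a space of dimension more than `ρ + n`. -/
theorem exists_notMem_range_of_finite {k L E V : Type*} [Field k] [Finite k]
    [AddCommGroup L] [Module k L] [AddCommGroup E] [Module k E] [AddCommGroup V] [Module k V]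
    [FiniteDimensional k V] {n ρ : ℕ} (hL : Module.finrank k L = n + 1)
    (φ : L →ₗ[k] E →ₗ[k] V)
    (hφ : ∀ x ≠ 0, Module.finrank k (LinearMap.range (φ x)) = ρ)
    (hV : ρ + n < Module.finrank k V) :
    ∃ v : V, ∀ x ≠ 0, v ∉ LinearMap.range (φ x) := by
  classical
  by_contra! hcon
  have : FiniteDimensional k L := Module.finite_of_finrank_eq_succ hL
  have : Finite L := Module.finite_of_finite k
  have : Finite V := Module.finite_of_finite k
  have := Fintype.ofFinite L
  have := Fintype.ofFinite V
  have := Fintype.ofFinite k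
  have hcover : (Finset.univ.erase (0 : V)) ⊆ (Finset.univ.erase (0 : L)).biUnion
      fun x => (Finset.univ.filter (· ∈ LinearMap.range (φ x))).erase 0 := by
    intro v hv
    obtain ⟨x, hx, hvx⟩ := hcon v
    simp only [Finset.mem_biUnion, Finset.mem_erase, Finset.mem_univ, and_true,
      Finset.mem_filter, true_and] at hv ⊢
    exact ⟨x, hx, hv, hvx⟩
  have hcard := (Finset.card_le_card hcover).trans
    (Finset.card_biUnion_le_card_mul _ _ (Fintype.card k ^ ρ - 1) fun x hx => by
      rw [Finset.card_erase_of_mem (Finset.mem_filter.2 ⟨Finset.mem_univ _, zero_mem _⟩), ← Fintype.card_subtype,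
        ← hφ x (Finset.ne_of_mem_erase hx)]
      exact le_of_eq (congrArg (· - 1) (Module.card_eq_pow_finrank (K := k)
        (V := LinearMap.range (φ x)))))
  rw [Finset.card_erase_of_mem (Finset.mem_univ _), Finset.card_erase_of_mem (Finset.mem_univ _),
    Finset.card_univ, Finset.card_univ, Module.card_eq_pow_finrank (K := k) (V := V),
    Module.card_eq_pow_finrank (K := k) (V := L), hL] at hcard
  have hq : 2 ≤ Fintype.card k := Fintype.one_lt_card
  set q := Fintype.card k
  -- With `S = q ^ (n + 1) ≥ 2` and `R = q ^ ρ ≥ 1`, `(S - 1) * (R - 1) < S * R - 1`, against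
  -- `hcard`.
  have h1 : 2 ≤ q ^ (n + 1) := hq.trans (Nat.le_self_pow (by omega) q)
  have h2 : 1 ≤ q ^ ρ := Nat.one_le_pow _ _ (by omega)
  have h3 : q ^ (n + 1) * q ^ ρ ≤ q ^ Module.finrank k V := by
    rw [← pow_add]
    exact Nat.pow_le_pow_right (by omega) (by omega)
  have h4 : 1 ≤ q ^ Module.finrank k V := Nat.one_le_pow _ _ (by omega)
  obtain ⟨s, hs⟩ := Nat.exists_eq_add_of_le h1
  obtain ⟨t, ht⟩ := Nat.exists_eq_add_of_le h2
  rw [hs, ht] at hcard h3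
  have h5 : (2 + s - 1) * (1 + t - 1) = (1 + s) * t := by congr 1 <;> omega
  have h6 : q ^ Module.finrank k V ≤ (1 + s) * t + 1 := by omega
  nlinarith

/-- The image of a polynomial map to a space of larger dimension is contained in a hypersurface. -/
theorem exists_ne_zero_eval_eq_zero_of_card_lt {k σ ι : Type*} [Field k] [Fintype σ] [Fintype ι]
    (g : ι → MvPolynomial σ k) (h : Fintype.card σ < Fintype.card ι) :
    ∃ p : MvPolynomial ι k, p ≠ 0 ∧
      ∀ z : σ → k, MvPolynomial.eval (fun i => MvPolynomial.eval z (g i)) p = 0 := by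
  have hg : ¬ AlgebraicIndependent k g := by
    intro hg
    have := hg.lift_cardinalMk_le_trdeg
    rw [MvPolynomial.trdeg_of_isDomain] at this
    simp at this
    omega
  rw [algebraicIndependent_iff] at hg
  push Not at hg
  obtain ⟨p, hp, hp0⟩ := hg
  refine ⟨p, hp0, fun z => ?_⟩
  have := congrArg (MvPolynomial.aeval z) hp
  rwa [map_zero, MvPolynomial.comp_aeval_apply, MvPolynomial.aeval_eq_eval] at this

/-- Finitely many polynomial images of `k ^ (n + ρ)` cover the ranges, and each lies in a
hypersurface. The product of their equations is nonzero, hence nonvanishing somewhere over an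
infinite field. -/
theorem exists_notMem_range_of_infinite {k L E V : Type*} [Field k] [Infinite k]
    [AddCommGroup L] [Module k L] [AddCommGroup E] [Module k E] [AddCommGroup V] [Module k V]
    [FiniteDimensional k E] [FiniteDimensional k V] {n ρ : ℕ} (hL : Module.finrank k L = n + 1)
    (φ : L →ₗ[k] E →ₗ[k] V)
    (hφ : ∀ x ≠ 0, Module.finrank k (LinearMap.range (φ x)) = ρ)
    (hV : ρ + n < Module.finrank k V) :
    ∃ v : V, ∀ x ≠ 0, v ∉ LinearMap.range (φ x) := by
  classical
  have : FiniteDimensional k L := Module.finite_of_finrank_eq_succ hL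
  let bL : Module.Basis (Fin (n + 1)) k L := Module.finBasisOfFinrankEq k L hL
  let bE := Module.finBasis k E
  let bV := Module.finBasis k V
  -- Polynomial chart: the `i`-th coordinate of `x` is `1`, and `φ x` is spanned by the images of
  -- the basis vectors `bE (J j)`.
  let g : Fin (n + 1) × (Fin ρ → Fin (Module.finrank k E)) → Fin (Module.finrank k V) →
      MvPolynomial (Fin n ⊕ Fin ρ) k := fun c r =>
    ∑ m, ∑ j, (Fin.insertNth c.1 1 (fun l => MvPolynomial.X (Sum.inl l)) :
      Fin (n + 1) → MvPolynomial (Fin n ⊕ Fin ρ) k) m * MvPolynomial.X (Sum.inr j) *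
      MvPolynomial.C (bV.repr (φ (bL m) (bE (c.2 j))) r)
  have hdep (c) := exists_ne_zero_eval_eq_zero_of_card_lt (g c) (by simp; omega)
  choose p hp0 hp using hdep
  obtain ⟨w, hw⟩ : ∃ w, MvPolynomial.eval w (∏ c, p c) ≠ 0 := by
    by_contra! h
    exact Finset.prod_ne_zero_iff.2 (fun c _ => hp0 c) (MvPolynomial.funext (by simpa using h))
  rw [map_prod, Finset.prod_ne_zero_iff] at hw
  refine ⟨bV.equivFun.symm w, fun x hx hmem => ?_⟩
  obtain ⟨i, hi⟩ : ∃ i, bL.repr x i ≠ 0 := by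
    by_contra! h
    exact hx (bL.repr.map_eq_zero_iff.1 (Finsupp.ext h))
  have hspan : Submodule.span k (Set.range (φ x ∘ bE)) = LinearMap.range (φ x) := by
    rw [Set.range_comp, Submodule.span_image, bE.span_eq, Submodule.map_top]
  obtain ⟨f, hf, hfspan, -⟩ :=
    Submodule.exists_fun_fin_finrank_span_eq k (Set.range (φ x ∘ bE))
  replace hfspan := hfspan.trans hspan
  have hr : Module.finrank k (Submodule.span k (Set.range (φ x ∘ bE))) = ρ := by
    rw [hspan, hφ x hx]
  generalize Module.finrank k (Submodule.span k (Set.range (φ x ∘ bE))) = r at f hf hfspan hr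
  subst hr
  choose J hJ using hf
  rw [← hfspan, Submodule.mem_span_range_iff_exists_fun] at hmem
  obtain ⟨t, ht⟩ := hmem
  apply hw (i, J) (Finset.mem_univ _)
  -- The chart rescales `x` by the inverse of its `i`-th coordinate; the coefficients `t` absorb the
  -- factor.
  convert hp (i, J) (Sum.elim (fun l => bL.repr x (i.succAbove l) / bL.repr x i)
    (fun j => bL.repr x i * t j)) using 2
  refine congrArg _ (funext fun r => ?_)
  have hcoord (m) : MvPolynomial.eval
      (Sum.elim (fun l => bL.repr x (i.succAbove l) / bL.repr x i) (fun j => bL.repr x i * t j))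
      ((Fin.insertNth i 1 (fun l => MvPolynomial.X (Sum.inl l)) :
        Fin (n + 1) → MvPolynomial (Fin n ⊕ Fin _) k) m) = bL.repr x m / bL.repr x i := by
    refine Fin.succAboveCases i ?_ (fun l => ?_) m <;> simp [hi]
  have hw' : w r = bV.repr (∑ j, t j • f j) r := by
    rw [ht, ← bV.equivFun_apply, LinearEquiv.apply_symm_apply]
  have hfx (j) : f j = ∑ m, bL.repr x m • φ (bL m) (bE (J j)) := by
    rw [← hJ j, Function.comp_apply]
    conv_lhs => rw [← bL.sum_repr x, map_sum, LinearMap.sum_apply]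
    simp only [map_smul, LinearMap.smul_apply]
  rw [hw']
  simp only [g, map_sum, map_mul, hcoord, MvPolynomial.eval_X, MvPolynomial.eval_C, Sum.elim_inr,
    hfx, Finset.smul_sum, map_smul, Finsupp.coe_finsetSum, Finset.sum_apply, Finsupp.smul_apply,
    smul_eq_mul]
  rw [Finset.sum_comm]
  refine Finset.sum_congr rfl fun m _ => Finset.sum_congr rfl fun j _ => ?_
  field_simp

theorem exists_notMem_range {k L E V : Type*} [Field k]
    [AddCommGroup L] [Module k L] [AddCommGroup E] [Module k E] [AddCommGroup V] [Module k V]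
    [FiniteDimensional k E] [FiniteDimensional k V] {n ρ : ℕ} (hL : Module.finrank k L = n + 1)
    (φ : L →ₗ[k] E →ₗ[k] V)
    (hφ : ∀ x ≠ 0, Module.finrank k (LinearMap.range (φ x)) = ρ)
    (hV : ρ + n < Module.finrank k V) :
    ∃ v : V, ∀ x ≠ 0, v ∉ LinearMap.range (φ x) := by
  cases finite_or_infinite k
  · exact exists_notMem_range_of_finite hL φ hφ hV
  · exact exists_notMem_range_of_infinite hL φ hφ hV

/-- A subspace of dimension `d` that meets trivially the ranges of a linear family of linear maps of
constant rank `ρ`; it serves as the center of a projection preserving ranks. -/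
theorem exists_finrank_eq_disjoint_range {k L E V : Type*} [Field k]
    [AddCommGroup L] [Module k L] [AddCommGroup E] [Module k E] [AddCommGroup V] [Module k V]
    [FiniteDimensional k E] [FiniteDimensional k V] {n ρ : ℕ} (hL : Module.finrank k L = n + 1)
    (φ : L →ₗ[k] E →ₗ[k] V)
    (hφ : ∀ x ≠ 0, Module.finrank k (LinearMap.range (φ x)) = ρ)
    (d : ℕ) (hd : d = 0 ∨ ρ + n + d ≤ Module.finrank k V) :
    ∃ K : Submodule k V, Module.finrank k K = d ∧
      ∀ x ≠ 0, Disjoint K (LinearMap.range (φ x)) := by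
  induction d with
  | zero => exact ⟨⊥, finrank_bot k V, fun _ _ => disjoint_bot_left⟩
  | succ d ih =>
    obtain ⟨K, hK, hdisj⟩ := ih (by omega)
    have hquot := K.finrank_quotient_add_finrank
    -- Modulo `K` the ranks are still `ρ`, and the dimension still exceeds `ρ + n`.
    obtain ⟨v, hv⟩ := exists_notMem_range (V := V ⧸ K) (ρ := ρ) hL (φ.compr₂ K.mkQ)
      (fun x hx => by
        rw [← hφ x hx]
        exact finrank_range_comp_of_disjoint K.mkQ (φ x) (by rw [K.ker_mkQ]; exact hdisj x hx))
      (by omega)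
    obtain ⟨w, rfl⟩ := K.mkQ_surjective v
    have : Nontrivial L := Module.nontrivial_of_finrank_pos (R := k) (by omega)
    have hwK : w ∉ K := fun hw => by
      obtain ⟨x, hx⟩ := exists_ne (0 : L)
      apply hv x hx
      rw [(K.mkQ_apply w).trans ((Submodule.Quotient.mk_eq_zero K).2 hw)]
      exact zero_mem _
    refine ⟨K ⊔ Submodule.span k {w}, ?_, fun x hx => ?_⟩
    · have h := Submodule.finrank_sup_add_finrank_inf_eq K (Submodule.span k {w})
      have hw0 : w ≠ 0 := fun h => hwK (h ▸ zero_mem _)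
      rw [((Submodule.disjoint_span_singleton' hw0).2 hwK).eq_bot, finrank_bot,
        finrank_span_singleton hw0, hK] at h
      exact h
    · rw [Submodule.disjoint_def]
      rintro _ hz ⟨y, rfl⟩
      obtain ⟨u, hu, z, hz, huz⟩ := Submodule.mem_sup.1 hz
      obtain ⟨c, rfl⟩ := Submodule.mem_span_singleton.1 hz
      by_cases hc : c = 0
      · rw [hc, zero_smul, add_zero] at huz
        exact Submodule.disjoint_def.1 (hdisj x hx) _ (huz ▸ hu) ⟨y, rfl⟩
      · refine absurd ⟨c⁻¹ • y, ?_⟩ (hv x hx)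
        have hu0 : K.mkQ u = 0 := (Submodule.Quotient.mk_eq_zero K).2 hu
        rw [LinearMap.compr₂_apply, map_smul, ← huz, map_smul, map_add, hu0, zero_add, map_smul,
          inv_smul_smul₀ hc]

theorem exists_projection {k L E V : Type*} [Field k]
    [AddCommGroup L] [Module k L] [AddCommGroup E] [Module k E] [AddCommGroup V] [Module k V]
    [FiniteDimensional k E] [FiniteDimensional k V] {n ρ : ℕ} (hL : Module.finrank k L = n + 1)
    (φ : L →ₗ[k] E →ₗ[k] V)
    (hφ : ∀ x ≠ 0, Module.finrank k (LinearMap.range (φ x)) = ρ) (α : ℕ) (hα : ρ + n ≤ α) :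
    ∃ p : V →ₗ[k] Fin α → k,
      Module.finrank k (LinearMap.range p) = min α (Module.finrank k V) ∧
      ∀ x ≠ 0, Module.finrank k (LinearMap.range (p ∘ₗ φ x)) = ρ := by
  -- If `α` is at least the dimension of `V`, truncated subtraction gives `K = ⊥` and the map is an
  -- embedding.
  obtain ⟨K, hK, hdisj⟩ := exists_finrank_eq_disjoint_range hL φ hφ
    (Module.finrank k V - α) (by omega)
  have hquot := K.finrank_quotient_add_finrank
  obtain ⟨e, he⟩ := (finrank_le_iff_exists_linearMap (R := k) (M := V ⧸ K) (M' := Fin α → k)).1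
    (by rw [Module.finrank_fin_fun]; omega)
  have hker : LinearMap.ker (e ∘ₗ K.mkQ) = K := by
    rw [LinearMap.ker_comp_of_ker_eq_bot _ (LinearMap.ker_eq_bot.2 he), K.ker_mkQ]
  refine ⟨e ∘ₗ K.mkQ, ?_, fun x hx => ?_⟩
  · have := LinearMap.finrank_range_add_finrank_ker (e ∘ₗ K.mkQ)
    rw [hker] at this
    omega
  · rw [finrank_range_comp_of_disjoint _ _ (hker.symm ▸ hdisj x hx), hφ x hx]

theorem exists_matrix_rank_mul_eq {k L : Type*} [Field k] [AddCommGroup L] [Module k L]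
    {a b n ρ : ℕ} (hL : Module.finrank k L = n + 1) (φ : L →ₗ[k] Matrix (Fin a) (Fin b) k)
    (hφ : ∀ x ≠ 0, (φ x).rank = ρ) (α : ℕ) (hα : ρ + n ≤ α) :
    ∃ P : Matrix (Fin α) (Fin a) k, P.rank = min α a ∧ ∀ x ≠ 0, (P * φ x).rank = ρ := by
  obtain ⟨p, hp, hpφ⟩ := exists_projection hL (Matrix.toLin'.toLinearMap ∘ₗ φ)
    (fun x hx => hφ x hx) α hα
  have hP (M : Matrix (Fin a) (Fin b) k) :
      (LinearMap.toMatrix' p * M).mulVecLin = p ∘ₗ M.mulVecLin := by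
    rw [Matrix.mulVecLin_mul, ← Matrix.toLin'_apply' (LinearMap.toMatrix' p),
      Matrix.toLin'_toMatrix']
  refine ⟨LinearMap.toMatrix' p, ?_, fun x hx => ?_⟩
  · rw [Matrix.rank, ← Matrix.toLin'_apply', Matrix.toLin'_toMatrix', hp, Module.finrank_fin_fun]
  · rw [Matrix.rank, hP]
    exact hpφ x hx

theorem proposition2p1 {k : Type*} [Field k] (a b n ρ : ℕ)
    (A : Submodule k (Matrix (Fin a) (Fin b) k))
    (hdim : Module.finrank k A = n + 1) (hrank : IsConstantRank A ρ)
    (α β : ℕ) (hα : ρ + n ≤ α) (hβ : ρ + n ≤ β) :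
    ∃ (P : Matrix (Fin α) (Fin a) k) (Q : Matrix (Fin b) (Fin β) k),
      P.rank = min α a ∧ Q.rank = min b β ∧
      Module.finrank k (A.map (matrixProjection P Q)) = n + 1 ∧
      IsConstantRank (A.map (matrixProjection P Q)) ρ := by
  have hA (x : A) (hx : x ≠ 0) : x.1.rank = ρ := hrank x x.2 (by simpa using hx)
  obtain ⟨P, hP, hPA⟩ := exists_matrix_rank_mul_eq hdim A.subtype hA α hα
  -- The factor `1` only serves to write `M ↦ P * M` as a linear map.
  obtain ⟨Q, hQ, hQA⟩ := exists_matrix_rank_mul_eq hdim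
    ((Matrix.transposeLinearEquiv (Fin α) (Fin b) k k).toLinearMap ∘ₗ
      matrixProjection P (1 : Matrix (Fin b) (Fin b) k) ∘ₗ A.subtype)
    (fun x hx => by
      have h : (P * x.1 * (1 : Matrix (Fin b) (Fin b) k)).transpose.rank = ρ := by
        rw [Matrix.mul_one, Matrix.rank_transpose]
        exact hPA x hx
      exact h) β hβ
  have hPQ (x : A) (hx : x ≠ 0) : (matrixProjection P Q.transpose x.1).rank = ρ := by
    have h : (Q * (P * x.1 * (1 : Matrix (Fin b) (Fin b) k)).transpose).rank = ρ := hQA x hx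
    rw [← h, ← Matrix.rank_transpose (Q * _), Matrix.transpose_mul, Matrix.transpose_transpose,
      Matrix.mul_one]
    rfl
  have hinj : Function.Injective ((matrixProjection P Q.transpose).domRestrict A) := by
    rw [← LinearMap.ker_eq_bot, LinearMap.ker_eq_bot']
    intro x hx
    by_contra hx0
    have h := hPQ x hx0
    rw [show matrixProjection P Q.transpose x.1 = 0 from hx, Matrix.rank_zero, ← hA x hx0,
      Matrix.rank] at h
    have h0 := LinearMap.range_eq_bot.1 (Submodule.finrank_eq_zero.1 h.symm)
    exact hx0 (Subtype.ext (Matrix.toLin'.map_eq_zero_iff.1 h0))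
  refine ⟨P, Q.transpose, hP, by rw [Matrix.rank_transpose, hQ, min_comm], ?_, ?_⟩
  · rw [← LinearMap.range_domRestrict, LinearMap.finrank_range_of_inj hinj, hdim]
  · rintro _ ⟨M, hM, rfl⟩ h0
    exact hPQ ⟨M, hM⟩ (fun h => h0 (by rw [show M = 0 from congrArg Subtype.val h, map_zero]))
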